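/- Let $\mathbb{F}_q$ be a finite field with $q$ elements, let $(\mathbb{F}_q(T))_\infty$ be the completion of $\mathbb{F}_q(T)$ at the place $\mathfrak{p}_\infty$ at infinity (the pole of $T$), and let $\mathfrak{P}$ be a place of an algebraic closure $\overline{\mathbb{F}_q(T)}$ lying above $\mathfrak{p}_\infty$, with completion $(\overline{\mathbb{F}_q(T)})_{\mathfrak{P}} \supseteq (\mathbb{F}_q(T))_\infty$. For $M = \sum_{i=0}^n a_i T^i \in \mathbb{F}_q[T]$ and $u \in \overline{\mathbb{F}_q(T)}$ let $u_q^M = \sum_{i=0}^n a_i (\phi_q + \mu_T)^i(u)$ be the Carlitz action, where $\phi_q(u) = u^q$ and $\mu_T(u) = Tu$. Let $$\mathbb{T}_q = \bigcup_{M \in \mathbb{F}_q[T]\setminus\{0\}} \{u \in \overline{\mathbb{F}_q(T)} : u_q^M = 0\}$$ be the set of all torsion points of this action, and let the $q$-unit circle $\mathbb{S}_q$ be the completion of $\mathbb{T}_q$ at $\mathfrak{P}$, i.e. the closure of $\mathbb{T}_q$ in $(\overline{\mathbb{F}_q(T)})_{\mathfrak{P}}$. Then for every $u \in \mathbb{S}_q$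 there exists $M \in (\mathbb{F}_q(T))_\infty$ such that $u^{q-1} = M$. -/

import Mathlib

namespace CarlitzCircle

noncomputable section

/-! ### The Carlitz action and its torsion points

`F` is a finite field with `q = Fintype.card F` elements, `RatFunc F` is the rational function
field `𝔽_q(T)` with `T = RatFunc.X`, and `AlgebraicClosure (RatFunc F)` is its algebraic closure. -/

section Carlitz

variable (F : Type*) [Field F] [Fintype F]

/-- The `𝔽_q`-linear operator `φ_q + μ_T`, that is `u ↦ u ^ q + T * u`, on the algebraic closure
of `𝔽_q(T)`. -/
def carlitzOperator : Module.End F (AlgebraicClosure (RatFunc F)) :=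
  (FiniteField.frobeniusAlgHom F (AlgebraicClosure (RatFunc F))).toLinearMap +
    LinearMap.mulLeft F (algebraMap (RatFunc F) (AlgebraicClosure (RatFunc F)) RatFunc.X)

/-- The Carlitz action `M ·_q u = ∑ i, a_i (φ_q + μ_T)^i (u)` of a polynomial
`M = ∑ i, a_i T^i` over `𝔽_q` on an element `u` of the algebraic closure of `𝔽_q(T)`. -/
def carlitzAction (M : Polynomial F) (u : AlgebraicClosure (RatFunc F)) :
    AlgebraicClosure (RatFunc F) :=
  Polynomial.aeval (carlitzOperator F) M u

/-- The set `Λ_{q,M}` of `M`-torsion points of the Carlitz action. -/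
def carlitzTorsion (M : Polynomial F) : Set (AlgebraicClosure (RatFunc F)) :=
  {u | carlitzAction F M u = 0}

/-- The set `𝕋_q` of roots of `q`-unity: the union of the `Λ_{q,M}` over all nonzero `M`. -/
def rootsOfQUnity : Set (AlgebraicClosure (RatFunc F)) :=
  ⋃ (M : Polynomial F) (_ : M ≠ 0), carlitzTorsion F M

end Carlitz

/-! ### Continuity of an algebraic extension of valued fields -/

section Extension

variable {K L Γ Γ₀ : Type*} [Field K] [Field L] [Algebra K L] [Algebra.IsAlgebraic K L]
  [LinearOrderedCommGroupWithZero Γ] [LinearOrderedCommGroupWithZero Γ₀]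

/-- In an algebraic extension, every value is bounded by the value of an element of the base. -/
theorem exists_le_valuation_algebraMap (v : Valuation L Γ₀) (z : L) :
    ∃ a : K, a ≠ 0 ∧ v z ≤ v (algebraMap K L a) := by
  by_contra! h
  have h1 : 1 < v z := by simpa using h 1 one_ne_zero
  have hlt (c : K) : v (algebraMap K L c) < v z := by
    by_cases hc : c = 0
    · simpa [hc] using zero_lt_one.trans h1
    · exact h c hc
  have hint : IsIntegral K z := (Algebra.IsAlgebraic.isAlgebraic z).isIntegral
  have hmon := minpoly.monic hint
  have h0 := minpoly.aeval K z
  rw [hmon.as_sum] at h0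
  simp only [map_add, map_pow, Polynomial.aeval_X, map_sum, map_mul, Polynomial.aeval_C] at h0
  have hz : z ^ (minpoly K z).natDegree =
      -∑ i ∈ Finset.range (minpoly K z).natDegree,
        algebraMap K L ((minpoly K z).coeff i) * z ^ i := eq_neg_of_add_eq_zero_left h0
  have hpos : v z ^ (minpoly K z).natDegree ≠ 0 := pow_ne_zero _ (zero_lt_one.trans h1).ne'
  have hsum : v (∑ i ∈ Finset.range (minpoly K z).natDegree,
      algebraMap K L ((minpoly K z).coeff i) * z ^ i) < v z ^ (minpoly K z).natDegree := by
    refine Valuation.map_sum_lt v hpos fun i hi ↦ ?_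
    rw [map_mul, map_pow]
    calc v (algebraMap K L ((minpoly K z).coeff i)) * v z ^ i
        < v z * v z ^ i :=
          mul_lt_mul_of_pos_right (hlt _) (zero_lt_iff.2 (pow_ne_zero _ (zero_lt_one.trans h1).ne'))
      _ = v z ^ (i + 1) := (pow_succ' _ _).symm
      _ ≤ v z ^ (minpoly K z).natDegree :=
          pow_le_pow_right₀ h1.le (Finset.mem_range.1 hi)
  have := congrArg v hz
  rw [map_pow, Valuation.map_neg] at this
  exact hsum.ne this.symm

/-- The inclusion of a valued field into an algebraic extension with an extended valuation is
continuous for the valuation topologies. -/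
theorem continuous_withVal_algebraMap (v₀ : Valuation K Γ) (v : Valuation L Γ₀)
    [v₀.HasExtension v] : Continuous (WithVal.map v₀ v (algebraMap K L)) := by
  refine continuous_of_continuousAt_zero _ ?_
  simp_rw [ContinuousAt, map_zero, (Valued.hasBasis_nhds_zero _ _).tendsto_iff
    (Valued.hasBasis_nhds_zero _ _), true_and, forall_const]
  intro γ
  obtain ⟨y, hy⟩ := MonoidWithZeroHom.ValueGroup₀.restrict₀_surjective
    (.ofClass (Valued.v (R := WithVal v))) γ.1
  replace hy : Valued.v.restrict y = γ.1 := hy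
  have hy0 : v y.ofVal ≠ 0 := by
    intro h
    apply γ.ne_zero
    rw [← hy, Valuation.restrict_eq_zero_iff]
    exact h
  obtain ⟨a, ha0, ha⟩ := exists_le_valuation_algebraMap (K := K) v (y.ofVal)⁻¹
  have ha' : v (algebraMap K L a⁻¹) ≤ v y.ofVal := by
    rw [map_inv₀] at ha
    rw [map_inv₀, map_inv₀]
    exact inv_le_of_inv_le₀ (zero_lt_iff.2 hy0) ha
  have hδ : Valued.v.restrict (WithVal.toVal v₀ a⁻¹) ≠ 0 := by
    rw [Ne, Valuation.restrict_eq_zero_iff, WithVal.valued_toVal]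
    simpa using ha0
  refine ⟨Units.mk0 _ hδ, fun x hx ↦ ?_⟩
  simp only [Units.val_mk0, Set.mem_ofPred_eq] at hx
  rw [Valuation.restrict_lt_iff, WithVal.valued_toVal, ← WithVal.apply_ofVal] at hx
  simp only [Set.mem_ofPred_eq, ← hy]
  rw [Valuation.restrict_lt_iff, ← WithVal.apply_ofVal, ← WithVal.apply_ofVal]
  exact lt_of_lt_of_le ((Valuation.HasExtension.val_map_lt_iff v₀ v _ _).2 hx) ha'

end Extension

/-! ### The real line and the `q`-unit circle

A branch of infinity is a valuation `v` on the algebraic closure of `𝔽_q(T)` that extends the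
valuation at infinity of `𝔽_q(T)` (up to equivalence of valuations). -/

section Circle

variable (F : Type*) [Field F]

/-- The "real line": the completion of `𝔽_q(T)` with respect to its valuation at infinity. -/
abbrev RealLine [DecidableEq (RatFunc F)] : Type _ := (RatFunc.inftyValuation F).Completion

variable {Γ₀ : Type*} [LinearOrderedCommGroupWithZero Γ₀]
  (v : Valuation (AlgebraicClosure (RatFunc F)) Γ₀)

/-- The canonical embedding of the real line into the completion of the algebraic closure of
`𝔽_q(T)` at a branch `v` of infinity: the continuous extension of the inclusion of `𝔽_q(T)`. -/
def realLineEmbedding [DecidableEq (RatFunc F)] [(RatFunc.inftyValuation F).HasExtension v] :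
    RealLine F →+* v.Completion :=
  UniformSpace.Completion.mapRingHom
    (WithVal.map (RatFunc.inftyValuation F) v
      (algebraMap (RatFunc F) (AlgebraicClosure (RatFunc F))))
    (continuous_withVal_algebraMap (RatFunc.inftyValuation F) v)

/-- The `q`-unit circle `𝕊_q`: the completion of the set `𝕋_q` of roots of `q`-unity at the
branch `v` of infinity, realized as the closure of `𝕋_q` in the completion of the algebraic
closure of `𝔽_q(T)` at `v`. -/
def qUnitCircle [Fintype F] : Set v.Completion :=
  closure ((fun u : AlgebraicClosure (RatFunc F) ↦ (u : v.Completion)) '' rootsOfQUnity F)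

end Circle

end

end CarlitzCircle

/-!
The point is that all torsion points of the Carlitz action lie on one line `θ · K_∞` over the real
line `K_∞`, where `θ ^ (q - 1) = -T`. Then `u ^ (q - 1) = -T (θ⁻¹ u) ^ (q - 1)` lies in `K_∞` for
every torsion point `u`, and for every limit of torsion points because `K_∞` is complete, hence
closed in the completion of the algebraic closure.

Writing `u = θ w` turns the operator `u ↦ u ^ q + T u` into `w ↦ T (w - w ^ q)`. Outside the disc
`v u ^ (q - 1) ≤ v T` the Carlitz operator strictly increases the valuation, so a torsion point
cannot lie there (`valuation_pow_le_of_mem_rootsOfQUnity`). In terms of `w`, the whole orbit under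
`g w = T (w - w ^ q)` stays in the closed unit disc. Hence `v (w - w ^ q) ≤ v T⁻¹ < 1`, so `w` is
congruent to a constant `c ∈ 𝔽_q`, and `w' = w - c` satisfies `w' = T⁻¹ g w + w' ^ q`. This
recursion determines `w'` from `g w` by the convergent series `∑ (T⁻¹ g w) ^ (q ^ i)` and gains a
factor `T⁻¹` in precision, so induction shows that `w` is a limit of elements of `𝔽_q(T)`
(`exists_algebraMap_valuation_sub_le_pow`). No exponential function, logarithm or period is needed.

On the topological side, the inclusion of a valued field into an algebraic extension with an
extended valuation is uniformly inducing (`isUniformInducing_withVal_algebraMap`), so the induced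
map of completions has closed range (`isClosed_range_completion_map`).
-/

namespace CarlitzCircle

open Filter Topology

/-! ### Algebras over a finite field with a valuation -/

section FiniteConstants

variable {F L Γ₀ : Type*} [Field F] [Fintype F] [Field L] [Algebra F L]
  [LinearOrderedCommGroupWithZero Γ₀] (v : Valuation L Γ₀)

theorem valuation_algebraMap_eq_one {c : F} (hc : c ≠ 0) : v (algebraMap F L c) = 1 := by
  have h : v (algebraMap F L c) ^ (Fintype.card F - 1) = 1 := by
    rw [← map_pow, ← map_pow, FiniteField.pow_card_sub_one_eq_one c hc, map_one, map_one]
  exact (pow_eq_one_iff_of_nonneg zero_le (Nat.sub_pos_of_lt Fintype.one_lt_card).ne').1 h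

theorem valuation_algebraMap_le_one (c : F) : v (algebraMap F L c) ≤ 1 := by
  rcases eq_or_ne c 0 with rfl | hc
  · simp
  · exact (valuation_algebraMap_eq_one v hc).le

theorem sub_pow_fintype_card (x y : L) :
    (x - y) ^ Fintype.card F = x ^ Fintype.card F - y ^ Fintype.card F :=
  map_sub (FiniteField.frobeniusAlgHom F L) x y

theorem pow_fintype_card_sub_self_eq_prod (x : L) :
    x ^ Fintype.card F - x = ∏ c : F, (x - algebraMap F L c) := by
  have h : (Polynomial.X ^ Fintype.card F - Polynomial.X : Polynomial F) =
      ∏ c : F, (Polynomial.X - Polynomial.C c) := by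
    have hmonic : (Polynomial.X ^ Fintype.card F - Polynomial.X : Polynomial F).Monic :=
      Polynomial.monic_X_pow_sub (by
        rw [Polynomial.degree_X]; exact_mod_cast Fintype.one_lt_card (α := F))
    have := Polynomial.prod_multiset_X_sub_C_of_monic_of_roots_card_eq hmonic (by
      rw [FiniteField.roots_X_pow_card_sub_X,
        FiniteField.X_pow_card_sub_X_natDegree_eq F Fintype.one_lt_card]
      rfl)
    rw [FiniteField.roots_X_pow_card_sub_X] at this
    exact this.symm
  simpa [map_prod] using congrArg (Polynomial.aeval x) h

/-- If `x ^ q` and `x` are congruent modulo the maximal ideal, then `x` is congruent to a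
constant: one of the factors of `x ^ q - x = ∏ c, (x - c)` has valuation less than one. -/
theorem exists_valuation_sub_algebraMap_lt_one {x : L} (hx : v (x - x ^ Fintype.card F) < 1) :
    ∃ c : F, v (x - algebraMap F L c) < 1 := by
  by_contra! h
  rw [Valuation.map_sub_swap, pow_fintype_card_sub_self_eq_prod, map_prod] at hx
  exact hx.not_ge (Finset.one_le_prod' fun c _ ↦ h c)

end FiniteConstants

/-! ### Approximating bounded orbits of `w ↦ t (w - w ^ q)` -/

section BoundedOrbit

variable {F K L Γ₀ : Type*} [Field F] [Fintype F] [Field K] [Field L] [Algebra F L] [Algebra F K]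
  [Algebra K L] [IsScalarTower F K L]
  [LinearOrderedCommGroupWithZero Γ₀] (v : Valuation L Γ₀)

/-- If `S` is contained in the closed unit disc and stable under `w ↦ t (w - w ^ q)`, where
`v t > 1`, then every element of `S` is approximated by elements of the base field `K` to any
precision `v t⁻¹ ^ n`. -/
theorem exists_algebraMap_valuation_sub_le_pow {t : K} (ht : 1 < v (algebraMap K L t))
    {S : Set L} (hS : ∀ w ∈ S, v w ≤ 1)
    (hmaps : ∀ w ∈ S, algebraMap K L t * (w - w ^ Fintype.card F) ∈ S) (n : ℕ) :
    ∀ w ∈ S, ∃ a : K, v (w - algebraMap K L a) ≤ (v (algebraMap K L t))⁻¹ ^ n := by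
  set τ := v (algebraMap K L t) with hτ
  have hτ0 : τ ≠ 0 := (zero_lt_one.trans ht).ne'
  have ht0 : algebraMap K L t ≠ 0 := fun h ↦ hτ0 (by rw [hτ, h, map_zero])
  have hτi : τ⁻¹ < 1 := inv_lt_one_of_one_lt₀ ht
  have hq : 2 ≤ Fintype.card F := Fintype.one_lt_card
  induction n with
  | zero => exact fun w hw ↦ ⟨0, by simpa using hS w hw⟩
  | succ n ih =>
    intro w hw
    set y := algebraMap K L t * (w - w ^ Fintype.card F) with hy
    obtain ⟨b, hb⟩ := ih y (hmaps w hw)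
    have hsub : w - w ^ Fintype.card F = (algebraMap K L t)⁻¹ * y := by
      rw [hy, inv_mul_cancel_left₀ ht0]
    have hsubv : v (w - w ^ Fintype.card F) ≤ τ⁻¹ := by
      rw [hsub, map_mul, map_inv₀]
      exact mul_le_of_le_one_right' (hS y (hmaps w hw))
    obtain ⟨c, hc⟩ := exists_valuation_sub_algebraMap_lt_one (F := F) v (hsubv.trans_lt hτi)
    set w' := w - algebraMap F L c with hw'
    -- `w' = t⁻¹ y + w' ^ q`, since constants are fixed by the `q`-th power map.
    have hrec : w' = (algebraMap K L t)⁻¹ * y + w' ^ Fintype.card F := by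
      rw [← hsub, hw', sub_pow_fintype_card, ← map_pow, FiniteField.pow_card]
      ring
    have hw'τ : v w' ≤ τ⁻¹ := by
      by_cases h0 : w' = 0
      · simp [h0]
      have hlt : v (w' ^ Fintype.card F) < v w' := by
        rw [map_pow]
        exact pow_lt_self_of_lt_one₀ (zero_lt_iff.2 ((Valuation.ne_zero_iff v).2 h0)) hc hq
      have : v (w' - w' ^ Fintype.card F) = v w' := Valuation.map_sub_eq_of_lt_left v hlt
      rw [← this, show w' - w' ^ Fintype.card F = w - w ^ Fintype.card F by
        rw [hsub]; linear_combination hrec]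
      exact hsubv
    -- Applying `a ↦ t⁻¹ b + a ^ q` repeatedly, starting from `0`, improves the precision of the
    -- approximation of `w'` by at least one power of `τ⁻¹` each time, up to the precision
    -- `τ⁻¹ ^ (n + 1)` to which `t⁻¹ b` approximates `t⁻¹ y`.
    have key : ∀ m, 1 ≤ m → m ≤ n + 1 → ∃ a : K, v (w' - algebraMap K L a) ≤ τ⁻¹ ^ m := by
      intro m hm
      induction m, hm using Nat.le_induction with
      | base => exact fun _ ↦ ⟨0, by simpa using hw'τ⟩
      | succ m hm ihm =>
        intro hmn
        obtain ⟨a, ha⟩ := ihm (by omega)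
        refine ⟨t⁻¹ * b + a ^ Fintype.card F, ?_⟩
        have : w' - algebraMap K L (t⁻¹ * b + a ^ Fintype.card F) =
            (algebraMap K L t)⁻¹ * (y - algebraMap K L b) +
              (w' - algebraMap K L a) ^ Fintype.card F := by
          rw [sub_pow_fintype_card]
          simp only [map_add, map_mul, map_inv₀, map_pow]
          linear_combination hrec
        rw [this]
        refine Valuation.map_add_le v ?_ ?_
        · rw [map_mul, map_inv₀]
          calc τ⁻¹ * v (y - algebraMap K L b) ≤ τ⁻¹ * τ⁻¹ ^ n := by gcongr
            _ = τ⁻¹ ^ (n + 1) := (pow_succ' _ _).symm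
            _ ≤ τ⁻¹ ^ (m + 1) := pow_le_pow_right_of_le_one' hτi.le hmn
        · rw [map_pow]
          calc v (w' - algebraMap K L a) ^ Fintype.card F ≤ (τ⁻¹ ^ m) ^ Fintype.card F := by
                gcongr
            _ = τ⁻¹ ^ (m * Fintype.card F) := (pow_mul _ _ _).symm
            _ ≤ τ⁻¹ ^ (m + 1) := pow_le_pow_right_of_le_one' hτi.le (by nlinarith)
    obtain ⟨a, ha⟩ := key (n + 1) (by omega) le_rfl
    refine ⟨algebraMap F K c + a, ?_⟩
    rwa [map_add, ← IsScalarTower.algebraMap_apply, ← sub_sub]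

end BoundedOrbit

/-! ### Torsion points of the Carlitz action -/

section Torsion

variable (F : Type*) [Field F] [Fintype F]

theorem carlitzOperator_apply (u : AlgebraicClosure (RatFunc F)) :
    carlitzOperator F u = u ^ Fintype.card F +
      algebraMap (RatFunc F) (AlgebraicClosure (RatFunc F)) RatFunc.X * u := rfl

theorem mem_rootsOfQUnity {u : AlgebraicClosure (RatFunc F)} :
    u ∈ rootsOfQUnity F ↔ ∃ M : Polynomial F, M ≠ 0 ∧
      Polynomial.aeval (carlitzOperator F) M u = 0 := by
  simp [rootsOfQUnity, carlitzTorsion, carlitzAction]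

theorem carlitzOperator_mem_rootsOfQUnity {u : AlgebraicClosure (RatFunc F)}
    (hu : u ∈ rootsOfQUnity F) : carlitzOperator F u ∈ rootsOfQUnity F := by
  rw [mem_rootsOfQUnity] at hu ⊢
  obtain ⟨M, hM, h⟩ := hu
  refine ⟨M, hM, ?_⟩
  have hcomm := Polynomial.aeval_mul (p := M) (q := Polynomial.X) (carlitzOperator F)
  rw [mul_comm, Polynomial.aeval_mul, Polynomial.aeval_X] at hcomm
  have := LinearMap.congr_fun hcomm u
  rw [Module.End.mul_apply, Module.End.mul_apply, h, map_zero] at this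
  exact this.symm

variable {F} {Γ₀ : Type*} [LinearOrderedCommGroupWithZero Γ₀]
  {v : Valuation (AlgebraicClosure (RatFunc F)) Γ₀}

/-- Outside the disc `v u ^ (q - 1) ≤ v T` the term `u ^ q` dominates `T u`, and the Carlitz
operator increases the valuation. -/
theorem valuation_lt_valuation_carlitzOperator
    (hX : 1 < v (algebraMap (RatFunc F) _ RatFunc.X)) {u : AlgebraicClosure (RatFunc F)}
    (hu : v (algebraMap (RatFunc F) _ RatFunc.X) < v u ^ (Fintype.card F - 1)) :
    v u < v (carlitzOperator F u) := by
  have hq : 1 < Fintype.card F := Fintype.one_lt_card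
  have hu1 : 1 < v u := by
    by_contra! h
    exact (hX.trans hu).not_ge (pow_le_one' h _)
  have hlt : v (algebraMap (RatFunc F) _ RatFunc.X * u) < v (u ^ Fintype.card F) := by
    rw [map_mul, map_pow, ← Nat.sub_add_cancel hq.le, pow_succ]
    exact mul_lt_mul_of_pos_right hu (zero_lt_one.trans hu1)
  rw [carlitzOperator_apply, Valuation.map_add_eq_of_lt_left v hlt, map_pow]
  exact lt_self_pow₀ hu1 hq

/-- Torsion points lie in the disc `v u ^ (q - 1) ≤ v T`: for `u` outside of it the valuations of
the iterates of the Carlitz operator at `u` increase strictly, so the leading term of `M` dominates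
the sum defining `M ·_q u`. -/
theorem valuation_pow_le_of_mem_rootsOfQUnity
    (hX : 1 < v (algebraMap (RatFunc F) _ RatFunc.X)) {u : AlgebraicClosure (RatFunc F)}
    (hu : u ∈ rootsOfQUnity F) :
    v u ^ (Fintype.card F - 1) ≤ v (algebraMap (RatFunc F) _ RatFunc.X) := by
  by_contra! h
  obtain ⟨M, hM, h0⟩ := (mem_rootsOfQUnity F).1 hu
  have horbit (n : ℕ) : v (algebraMap (RatFunc F) _ RatFunc.X) <
      v ((carlitzOperator F ^ n) u) ^ (Fintype.card F - 1) := by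
    induction n with
    | zero => simpa using h
    | succ n ih =>
      rw [pow_succ', Module.End.mul_apply]
      exact ih.trans_le (pow_le_pow_left' (valuation_lt_valuation_carlitzOperator hX ih).le _)
  have hmono : StrictMono fun n ↦ v ((carlitzOperator F ^ n) u) := strictMono_nat_of_lt_succ
    fun n ↦ by
      rw [pow_succ', Module.End.mul_apply]
      exact valuation_lt_valuation_carlitzOperator hX (horbit n)
  have hne : v ((carlitzOperator F ^ M.natDegree) u) ≠ 0 := by
    intro h
    have := horbit M.natDegree
    rw [h, zero_pow (Nat.sub_pos_of_lt Fintype.one_lt_card).ne'] at this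
    exact not_lt_zero this
  have hlead : v (M.leadingCoeff • (carlitzOperator F ^ M.natDegree) u) =
      v ((carlitzOperator F ^ M.natDegree) u) := by
    rw [Algebra.smul_def, map_mul,
      valuation_algebraMap_eq_one v (Polynomial.leadingCoeff_ne_zero.2 hM), one_mul]
  have hlow : v (∑ i ∈ Finset.range M.natDegree, M.coeff i • (carlitzOperator F ^ i) u) <
      v ((carlitzOperator F ^ M.natDegree) u) := by
    refine Valuation.map_sum_lt v hne fun i hi ↦ ?_
    rw [Algebra.smul_def, map_mul]
    exact (mul_le_of_le_one_left' (valuation_algebraMap_le_one v _)).trans_lt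
      (hmono (Finset.mem_range.1 hi))
  rw [Polynomial.aeval_eq_sum_range, Finset.sum_range_succ, LinearMap.add_apply,
    LinearMap.sum_apply] at h0
  simp only [LinearMap.smul_apply, Polynomial.coeff_natDegree] at h0
  have := congrArg v h0
  rw [Valuation.map_add_eq_of_lt_right v (hlow.trans_eq hlead.symm), hlead, map_zero] at this
  exact hne this

end Torsion

/-! ### The completion of an algebraic extension of valued fields -/

section Topology

variable {K L Γ Γ₀ : Type*} [Field K] [Field L] [Algebra K L] [Algebra.IsAlgebraic K L]
  [LinearOrderedCommGroupWithZero Γ] [LinearOrderedCommGroupWithZero Γ₀]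

theorem restrict_lt_restrict_iff_withVal (v : Valuation K Γ) {x y : WithVal v} :
    (Valued.v (R := WithVal v)).restrict x < (Valued.v (R := WithVal v)).restrict y ↔
      v x.ofVal < v y.ofVal := by
  rw [Valuation.restrict_lt_iff, ← WithVal.apply_ofVal, ← WithVal.apply_ofVal]

/-- The balls `v x < v z` with `z ≠ 0` in the field form a basis of neighbourhoods of zero, so that
only values that are attained are needed as radii. -/
theorem hasBasis_nhds_zero_withVal (v : Valuation K Γ) :
    (𝓝 (0 : WithVal v)).HasBasis (fun z : K ↦ z ≠ 0) fun z ↦ {x | v x.ofVal < v z} := by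
  refine (Valued.hasBasis_nhds_zero (WithVal v) Γ).to_hasBasis (fun γ _ ↦ ?_) fun z hz ↦ ?_
  · obtain ⟨y, hy⟩ := MonoidWithZeroHom.ValueGroup₀.restrict₀_surjective
      (.ofClass (Valued.v (R := WithVal v))) γ.1
    replace hy : Valued.v.restrict y = γ.1 := hy
    refine ⟨y.ofVal, ?_, fun x hx ↦ ?_⟩
    · intro h
      apply γ.ne_zero
      rw [← hy, Valuation.restrict_eq_zero_iff, ← WithVal.apply_ofVal, h, map_zero]
    · rw [Set.mem_ofPred_eq, ← hy]
      exact (restrict_lt_restrict_iff_withVal v).2 hx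
  · have hδ : (Valued.v (R := WithVal v)).restrict (WithVal.toVal v z) ≠ 0 := by
      rw [Ne, Valuation.restrict_eq_zero_iff, WithVal.valued_toVal]
      simpa using hz
    exact ⟨Units.mk0 _ hδ, trivial, fun x hx ↦ (restrict_lt_restrict_iff_withVal v).1 hx⟩

theorem isUniformInducing_withVal_algebraMap (v₀ : Valuation K Γ) (v : Valuation L Γ₀)
    [v₀.HasExtension v] : IsUniformInducing (WithVal.map v₀ v (algebraMap K L)) := by
  refine AddMonoidHom.isUniformInducing_of_isInducing
    ((IsTopologicalAddGroup.isInducing_iff_nhds_zero (f := WithVal.map v₀ v (algebraMap K L))).2 ?_)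
  refine le_antisymm ?_ ?_
  · rw [← map_le_iff_le_comap]
    simpa [ContinuousAt, Tendsto] using (continuous_withVal_algebraMap v₀ v).continuousAt (x := 0)
  · rw [((hasBasis_nhds_zero_withVal v).comap _).le_basis_iff (hasBasis_nhds_zero_withVal v₀)]
    refine fun z hz ↦ ⟨algebraMap K L z, by simpa using hz, fun x hx ↦ ?_⟩
    exact (Valuation.HasExtension.val_map_lt_iff v₀ v _ _).1 hx

theorem isClosed_range_completion_map (v₀ : Valuation K Γ) (v : Valuation L Γ₀)
    [v₀.HasExtension v] :
    IsClosed (Set.range (UniformSpace.Completion.map (WithVal.map v₀ v (algebraMap K L)))) := by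
  set f := WithVal.map v₀ v (algebraMap K L)
  have hg := UniformSpace.Completion.isDenseInducing_coe.isUniformInducing_extend
    (UniformSpace.Completion.isUniformInducing_coe _)
    ((UniformSpace.Completion.isUniformInducing_coe _).comp
      (isUniformInducing_withVal_algebraMap v₀ v))
  -- `Completion.map f` is only propositionally equal to the extension by density of `f`.
  have hmap := UniformSpace.Completion.map_unique (f := f) hg.uniformContinuous fun a ↦
    (UniformSpace.Completion.isDenseInducing_coe.extend_eq_at
      ((UniformSpace.Completion.continuous_coe _).comp
        (continuous_withVal_algebraMap v₀ v)).continuousAt).symm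
  rw [hmap]
  exact hg.isComplete_range.isClosed

/-- An element of `L` that can be approximated arbitrarily well by elements of `K` comes from the
completion of `K`. -/
theorem coe_mem_range_completion_map (v₀ : Valuation K Γ) (v : Valuation L Γ₀)
    [v₀.HasExtension v] {x : L} (hx : ∀ z : L, z ≠ 0 → ∃ a : K, v (x - algebraMap K L a) < v z) :
    (x : v.Completion) ∈
      Set.range (UniformSpace.Completion.map (WithVal.map v₀ v (algebraMap K L))) := by
  have hcl : WithVal.toVal v x ∈ closure (Set.range (WithVal.map v₀ v (algebraMap K L))) := by
    have hb := (hasBasis_nhds_zero_withVal v).comap fun y ↦ y - WithVal.toVal v x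
    rw [nhds_translation_sub] at hb
    rw [mem_closure_iff_nhds_basis hb]
    intro z hz
    obtain ⟨a, ha⟩ := hx z hz
    refine ⟨_, ⟨WithVal.toVal v₀ a, rfl⟩, ?_⟩
    rw [Valuation.map_sub_swap] at ha
    simpa using ha
  refine (isClosed_range_completion_map v₀ v).closure_subset_iff.2 ?_
    (image_closure_subset_closure_image (UniformSpace.Completion.continuous_coe _) ⟨_, hcl, rfl⟩)
  rintro _ ⟨_, ⟨a, rfl⟩, rfl⟩
  exact ⟨a, UniformSpace.Completion.map_coe
    (isUniformInducing_withVal_algebraMap v₀ v).uniformContinuous a⟩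

end Topology

/-! ### Torsion points in the completion at infinity -/

section Circle

variable (F : Type*) [Field F] [DecidableEq (RatFunc F)]
  {Γ₀ : Type*} [LinearOrderedCommGroupWithZero Γ₀]
  (v : Valuation (AlgebraicClosure (RatFunc F)) Γ₀) [(RatFunc.inftyValuation F).HasExtension v]

theorem one_lt_valuation_X :
    1 < v (algebraMap (RatFunc F) (AlgebraicClosure (RatFunc F)) RatFunc.X) := by
  rw [← not_le, Valuation.HasExtension.val_map_le_one_iff (RatFunc.inftyValuation F) v, not_le,
    RatFunc.inftyValuation.X, ← WithZero.exp_zero, WithZero.exp_lt_exp]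
  exact zero_lt_one

/-- The powers of `T⁻¹` tend to zero for `v`, whatever the value group of `v`, because the algebraic
closure is algebraic over `𝔽_q(T)`. -/
theorem exists_inv_valuation_X_pow_lt {z : AlgebraicClosure (RatFunc F)} (hz : z ≠ 0) :
    ∃ n : ℕ, (v (algebraMap (RatFunc F) (AlgebraicClosure (RatFunc F)) RatFunc.X))⁻¹ ^ n < v z := by
  obtain ⟨a, ha0, ha⟩ := exists_le_valuation_algebraMap (K := RatFunc F) v z⁻¹
  refine ⟨(a.intDegree + 1).toNat, ?_⟩
  have hlt : v (algebraMap _ _ a) <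
      v (algebraMap (RatFunc F) _ (RatFunc.X ^ (a.intDegree + 1).toNat)) := by
    rw [Valuation.HasExtension.val_map_lt_iff (RatFunc.inftyValuation F) v, map_pow,
      RatFunc.inftyValuation_apply, RatFunc.inftyValuation_of_nonzero F ha0,
      RatFunc.inftyValuation.X, ← WithZero.exp_nsmul, WithZero.exp_lt_exp]
    simp only [nsmul_eq_mul, mul_one]
    omega
  have := ha.trans_lt hlt
  rw [map_inv₀, map_pow, map_pow] at this
  rw [inv_pow]
  exact inv_lt_of_inv_lt₀ (zero_lt_iff.2 ((Valuation.ne_zero_iff v).2 hz)) this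

/-- The assertion for a torsion point `u`: for `θ ^ (q - 1) = -T`, the quotient `θ⁻¹ u` lies in the
real line. -/
theorem coe_pow_mem_range_realLineEmbedding [Fintype F] {u : AlgebraicClosure (RatFunc F)}
    (hu : u ∈ rootsOfQUnity F) :
    (u : v.Completion) ^ (Fintype.card F - 1) ∈ (realLineEmbedding F v).range := by
  set X := algebraMap (RatFunc F) (AlgebraicClosure (RatFunc F)) RatFunc.X with hX
  have hX1 : 1 < v X := one_lt_valuation_X F v
  have hq : 0 < Fintype.card F - 1 := Nat.sub_pos_of_lt Fintype.one_lt_card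
  obtain ⟨θ, hθ⟩ := IsAlgClosed.exists_pow_nat_eq (-X) hq
  have hvθ : v θ ^ (Fintype.card F - 1) = v X := by rw [← map_pow, hθ, Valuation.map_neg]
  have hvθ0 : v θ ≠ 0 := by
    intro h
    rw [h, zero_pow hq.ne'] at hvθ
    exact not_lt_zero (hvθ ▸ hX1)
  have hθ0 : θ ≠ 0 := (Valuation.ne_zero_iff v).1 hvθ0
  have hθq : θ ^ Fintype.card F = -X * θ := by
    rw [← hθ, ← pow_succ, Nat.sub_add_cancel Fintype.card_pos]
  -- The `w` with `θ w` torsion are bounded and stable under `w ↦ T (w - w ^ q)`.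
  have happrox := exists_algebraMap_valuation_sub_le_pow (F := F) (K := RatFunc F) v
    (t := RatFunc.X) hX1 (S := {w | θ * w ∈ rootsOfQUnity F})
    (fun w hw ↦ by
      have := valuation_pow_le_of_mem_rootsOfQUnity hX1 hw
      rw [map_mul, mul_pow, hvθ] at this
      exact (pow_le_one_iff_of_nonneg zero_le hq.ne').1
        ((mul_le_iff_le_one_right (zero_lt_one.trans hX1)).1 this))
    (fun w hw ↦ by
      have := carlitzOperator_mem_rootsOfQUnity F hw
      rw [carlitzOperator_apply, mul_pow, hθq] at this
      rw [Set.mem_ofPred_eq]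
      convert this using 1
      ring)
  have hw : θ * (θ⁻¹ * u) ∈ rootsOfQUnity F := by rwa [mul_inv_cancel_left₀ hθ0]
  obtain ⟨m, hm⟩ := coe_mem_range_completion_map (RatFunc.inftyValuation F) v
    (x := θ⁻¹ * u) fun z hz ↦ by
      obtain ⟨n, hn⟩ := exists_inv_valuation_X_pow_lt F v hz
      obtain ⟨a, ha⟩ := happrox n _ hw
      exact ⟨a, ha.trans_lt hn⟩
  have hmem : ((θ⁻¹ * u : AlgebraicClosure (RatFunc F)) : v.Completion) ∈
      (realLineEmbedding F v).range := ⟨m, hm⟩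
  have hXmem : ((X : AlgebraicClosure (RatFunc F)) : v.Completion) ∈
      (realLineEmbedding F v).range :=
    ⟨((WithVal.toVal (RatFunc.inftyValuation F) RatFunc.X :) : RealLine F),
      UniformSpace.Completion.mapRingHom_coe _ _⟩
  have hu' : (u : v.Completion) ^ (Fintype.card F - 1) =
      -(X : v.Completion) * ((θ⁻¹ * u : AlgebraicClosure (RatFunc F)) : v.Completion) ^
        (Fintype.card F - 1) := by
    have : u ^ (Fintype.card F - 1) = -X * (θ⁻¹ * u) ^ (Fintype.card F - 1) := by
      rw [← hθ, ← mul_pow, mul_inv_cancel_left₀ hθ0]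
    have := congrArg (fun y ↦ UniformSpace.Completion.coeRingHom (WithVal.toVal v y)) this
    rw [WithVal.toVal_pow, WithVal.toVal_mul, WithVal.toVal_neg, WithVal.toVal_pow, map_pow,
      map_mul, map_neg, map_pow] at this
    exact this
  rw [hu']
  exact mul_mem (neg_mem hXmem) (pow_mem hmem _)

end Circle
end CarlitzCircle

theorem mainTheorem2 (F : Type*) [Field F] [Fintype F] [DecidableEq (RatFunc F)]
    {Γ₀ : Type*} [LinearOrderedCommGroupWithZero Γ₀]
    (v : Valuation (AlgebraicClosure (RatFunc F)) Γ₀)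
    [(RatFunc.inftyValuation F).HasExtension v]
    (u : v.Completion) (hu : u ∈ CarlitzCircle.qUnitCircle F v) :
    ∃ M : CarlitzCircle.RealLine F,
      u ^ (Fintype.card F - 1) = CarlitzCircle.realLineEmbedding F v M := by
  have hclosed : IsClosed (Set.range (CarlitzCircle.realLineEmbedding F v)) :=
    CarlitzCircle.isClosed_range_completion_map (RatFunc.inftyValuation F) v
  have hmaps : Set.MapsTo (fun x : v.Completion ↦ x ^ (Fintype.card F - 1))
      ((fun u : AlgebraicClosure (RatFunc F) ↦ (u : v.Completion)) ''
        CarlitzCircle.rootsOfQUnity F)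
      (Set.range (CarlitzCircle.realLineEmbedding F v)) := by
    rintro _ ⟨x, hx, rfl⟩
    exact CarlitzCircle.coe_pow_mem_range_realLineEmbedding F v hx
  obtain ⟨M, hM⟩ := hmaps.closure_left (continuous_pow _) hclosed hu
  exact ⟨M, hM.symm⟩
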